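/- Let $N\ge 1$ and, for $k=0,\dots,N-1$, let $A_k\in\mathbb R^{n\times n}$ be invertible, $B_k\in\mathbb R^{n\times p}$, $D_k\in\mathbb R^{n\times q}$, $Q_k=Q_k^{\mathsf T}\succeq 0$ in $\mathbb R^{n\times n}$ and $R_k=R_k^{\mathsf T}\succ 0$ in $\mathbb R^{p\times p}$. With $\Phi_A(N,i+1)=A_{N-1}\cdots A_{i+1}$ (and $\Phi_A(N,N)=I_n$), assume that the reachability Gramian $\sum_{i=0}^{N-1}\Phi_A(N,i+1)B_iB_i^{\mathsf T}\Phi_A(N,i+1)^{\mathsf T}$ is positive definite, and let $\bar\Sigma_0\succ 0$ and $\bar\Sigma_N\succ D_{N-1}D_{N-1}^{\mathsf T}$ be symmetric. Consider the relaxed covariance steering problem $$\min_{\Sigma_k,U_k,Y_k}\ \sum_{k=0}^{N-1}\operatorname{tr}(Q_k\Sigma_k)+\operatorname{tr}(R_kY_k)$$ over $\Sigma_k\succ0$ in $\mathbb R^{n\times n}$ $(0\le k\le N)$ with $\Sigma_0=\bar\Sigma_0$, $\Sigma_N=\bar\Sigma_N$, and over $U_k\in\mathbb R^{p\times n}$ and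 symmetric $Y_k\in\mathbb R^{p\times p}$ $(0\le k\le N-1)$, subject for all $k=0,\dots,N-1$ to $$C_k:=U_k\Sigma_k^{-1}U_k^{\mathsf T}-Y_k\preceq 0,$$ $$A_k\Sigma_kA_k^{\mathsf T}+B_kU_kA_k^{\mathsf T}+A_kU_k^{\mathsf T}B_k^{\mathsf T}+B_kY_kB_k^{\mathsf T}+D_kD_k^{\mathsf T}-\Sigma_{k+1}=0.$$ This relaxation is lossless: every optimal solution $(\Sigma_k,U_k,Y_k)$ satisfies $C_k=0$ for all $k=0,\dots,N-1$, and consequently $(\Sigma_k,U_k)$ is an optimal solution of the original non-convex covariance steering problem, obtained by requiring $Y_k=U_k\Sigma_k^{-1}U_k^{\mathsf T}$ instead of $C_k\preceq0$, i.e. of minimizing $\sum_{k=0}^{N-1}\operatorname{tr}(Q_k\Sigma_k)+\operatorname{tr}(R_kU_k\Sigma_k^{-1}U_k^{\mathsf T})$ subject to $A_k\Sigma_kA_k^{\mathsf T}+B_kU_kA_k^{\mathsf T}+A_kU_k^{\mathsf T}B_k^{\mathsf T}+B_kU_k\Sigma_k^{-1}U_k^{\mathsf T}B_k^{\mathsf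 T}+D_kD_k^{\mathsf T}-\Sigma_{k+1}=0$ for all $k$, with the same boundary conditions and $\Sigma_k\succ0$. -/

import Mathlib

open scoped Matrix

namespace CovSteering

/-- The data of a discrete-time covariance steering problem: coefficient matrices of
`x_{k+1} = A_k x_k + B_k u_k + D_k w_k`, the weights `Q_k`, `R_k` of the quadratic cost, and the
prescribed covariances `S0` of `x_0` and `SN` of `x_N`. For a horizon `N` only the matrices with
index `k < N` are used. -/
structure Data (n p q : ℕ) where
  A : ℕ → Matrix (Fin n) (Fin n) ℝ
  B : ℕ → Matrix (Fin n) (Fin p) ℝ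
  D : ℕ → Matrix (Fin n) (Fin q) ℝ
  Q : ℕ → Matrix (Fin n) (Fin n) ℝ
  R : ℕ → Matrix (Fin p) (Fin p) ℝ
  S0 : Matrix (Fin n) (Fin n) ℝ
  SN : Matrix (Fin n) (Fin n) ℝ

variable {n p q : ℕ}

/-- `transitionSteps A l m = A_{l+m-1} ⋯ A_{l+1} A_l`, the product of `m` factors. -/
def transitionSteps (A : ℕ → Matrix (Fin n) (Fin n) ℝ) (l : ℕ) : ℕ → Matrix (Fin n) (Fin n) ℝ
  | 0 => 1
  | m + 1 => A (l + m) * transitionSteps A l m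

/-- The state transition matrix `Φ_A(k, l) = A_{k-1} ⋯ A_l` for `l ≤ k`. -/
def transition (A : ℕ → Matrix (Fin n) (Fin n) ℝ) (k l : ℕ) : Matrix (Fin n) (Fin n) ℝ :=
  transitionSteps A l (k - l)

/-- The reachability Gramian `G(N, 0) = ∑_{i=0}^{N-1} Φ_A(N, i+1) B_i B_iᵀ Φ_A(N, i+1)ᵀ`. -/
def gramian (P : Data n p q) (N : ℕ) : Matrix (Fin n) (Fin n) ℝ :=
  ∑ i ∈ Finset.range N,
    transition P.A N (i + 1) * P.B i * (P.B i)ᵀ * (transition P.A N (i + 1))ᵀ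

/-- `C_k = U_k Σ_k⁻¹ U_kᵀ - Y_k`, for given `Σ_k`, `U_k`, `Y_k`. -/
noncomputable def relaxGap (S : Matrix (Fin n) (Fin n) ℝ) (U : Matrix (Fin p) (Fin n) ℝ)
    (Y : Matrix (Fin p) (Fin p) ℝ) : Matrix (Fin p) (Fin p) ℝ :=
  U * S⁻¹ * Uᵀ - Y

/-- The residual `G_k` of the relaxed covariance equation at step `k`,
`A_k Σ_k A_kᵀ + B_k U_k A_kᵀ + A_k U_kᵀ B_kᵀ + B_k Y_k B_kᵀ + D_k D_kᵀ - Σ_{k+1}`. -/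
def covResidual (P : Data n p q) (k : ℕ) (S : Matrix (Fin n) (Fin n) ℝ)
    (U : Matrix (Fin p) (Fin n) ℝ) (Y : Matrix (Fin p) (Fin p) ℝ)
    (Snext : Matrix (Fin n) (Fin n) ℝ) : Matrix (Fin n) (Fin n) ℝ :=
  P.A k * S * (P.A k)ᵀ + P.B k * U * (P.A k)ᵀ + P.A k * Uᵀ * (P.B k)ᵀ
    + P.B k * Y * (P.B k)ᵀ + P.D k * (P.D k)ᵀ - Snext

/-- Feasible points of the relaxed problem. The covariances are positive definite; for points
that satisfy the other constraints this only says that the inverses `Σ_k⁻¹` exist. -/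
structure RelaxedFeasible (P : Data n p q) (N : ℕ) (S : ℕ → Matrix (Fin n) (Fin n) ℝ)
    (U : ℕ → Matrix (Fin p) (Fin n) ℝ) (Y : ℕ → Matrix (Fin p) (Fin p) ℝ) : Prop where
  init : S 0 = P.S0
  final : S N = P.SN
  posDef : ∀ k ≤ N, (S k).PosDef
  gap : ∀ k < N, (-(relaxGap (S k) (U k) (Y k))).PosSemidef
  cov : ∀ k < N, covResidual P k (S k) (U k) (Y k) (S (k + 1)) = 0

/-- The cost `∑_{k=0}^{N-1} tr(Q_k Σ_k) + tr(R_k Y_k)` of the relaxed problem. -/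
def relaxedCost (P : Data n p q) (N : ℕ) (S : ℕ → Matrix (Fin n) (Fin n) ℝ)
    (Y : ℕ → Matrix (Fin p) (Fin p) ℝ) : ℝ :=
  ∑ k ∈ Finset.range N, ((P.Q k * S k).trace + (P.R k * Y k).trace)

/-- Optimal solutions of the relaxed problem: feasible points of minimal cost. -/
def RelaxedOptimal (P : Data n p q) (N : ℕ) (S : ℕ → Matrix (Fin n) (Fin n) ℝ)
    (U : ℕ → Matrix (Fin p) (Fin n) ℝ) (Y : ℕ → Matrix (Fin p) (Fin p) ℝ) : Prop :=
  RelaxedFeasible P N S U Y ∧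
    ∀ S' U' Y', RelaxedFeasible P N S' U' Y' → relaxedCost P N S Y ≤ relaxedCost P N S' Y'

/-- Feasible points of the original (non-convex) covariance steering problem. -/
structure OriginalFeasible (P : Data n p q) (N : ℕ) (S : ℕ → Matrix (Fin n) (Fin n) ℝ)
    (U : ℕ → Matrix (Fin p) (Fin n) ℝ) : Prop where
  init : S 0 = P.S0
  final : S N = P.SN
  posDef : ∀ k ≤ N, (S k).PosDef
  cov : ∀ k < N,
    P.A k * S k * (P.A k)ᵀ + P.B k * U k * (P.A k)ᵀ + P.A k * (U k)ᵀ * (P.B k)ᵀ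
      + P.B k * (U k * (S k)⁻¹ * (U k)ᵀ) * (P.B k)ᵀ + P.D k * (P.D k)ᵀ - S (k + 1) = 0

/-- The cost `∑_{k=0}^{N-1} tr(Q_k Σ_k) + tr(R_k U_k Σ_k⁻¹ U_kᵀ)` of the original problem. -/
noncomputable def originalCost (P : Data n p q) (N : ℕ) (S : ℕ → Matrix (Fin n) (Fin n) ℝ)
    (U : ℕ → Matrix (Fin p) (Fin n) ℝ) : ℝ :=
  ∑ k ∈ Finset.range N,
    ((P.Q k * S k).trace + (P.R k * (U k * (S k)⁻¹ * (U k)ᵀ)).trace)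

/-- Optimal solutions of the original covariance steering problem. -/
def OriginalOptimal (P : Data n p q) (N : ℕ) (S : ℕ → Matrix (Fin n) (Fin n) ℝ)
    (U : ℕ → Matrix (Fin p) (Fin n) ℝ) : Prop :=
  OriginalFeasible P N S U ∧
    ∀ S' U', OriginalFeasible P N S' U' → originalCost P N S U ≤ originalCost P N S' U'

end CovSteering

namespace CovSteering

variable {n p q : ℕ}

/-! A nonzero gap leaves slack to lower the cost at one step with all covariances fixed, so no
multipliers are needed. With `A E = B`, moving `U` by `-N Eᵀ` and `Y` by `N + Nᵀ` leaves the
covariance equation intact for every `N` (`covResidual_perturb`). The slack `-C` dominates some `v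
vᵀ ≠ 0` (`exists_rankOne_le`); a small rank-one `N` close to a negative multiple of `v vᵀ` keeps `-C
⪰ 0`, while `R ≻ 0` makes `tr(R Y)` drop (`exists_cheaper_step`). Once all gaps vanish, optimality
passes to the original problem, whose feasible points embed in the relaxed one at equal cost. -/

lemma exists_small_pos {a lam : ℝ} (b : ℝ) (ha : 0 < a) (hlam : 0 ≤ lam) :
    ∃ e : ℝ, 0 < e ∧ e ^ 2 * lam ≤ 1 ∧ e * b < a := by
  have hb : 0 ≤ |b| / a := by positivity
  have hK : 0 < 1 + lam + |b| / a := by positivity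
  refine ⟨(1 + lam + |b| / a)⁻¹, by positivity, ?_, ?_⟩
  · rw [inv_pow, inv_mul_le_iff₀ (by positivity)]
    nlinarith
  · rw [inv_mul_lt_iff₀ hK]
    have h1 : |b| / a * a = |b| := div_mul_cancel₀ _ ha.ne'
    have h2 : b ≤ |b| := le_abs_self b
    nlinarith

open scoped MatrixOrder in
/-- A nonzero positive semidefinite matrix dominates a nonzero rank-one matrix. -/
lemma exists_rankOne_le {M : Matrix (Fin p) (Fin p) ℝ} (hM : M.PosSemidef) (hne : M ≠ 0) :
    ∃ v : Fin p → ℝ, v ≠ 0 ∧ (M - Matrix.vecMulVec v v).PosSemidef := by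
  -- `Gᴴ * G` is the sum of the outer squares of the rows of `G`, so any nonzero row serves as `v`.
  obtain ⟨G, rfl⟩ : ∃ G : Matrix (Fin p) (Fin p) ℝ, M = Gᴴ * G :=
    CStarAlgebra.nonneg_iff_eq_star_mul_self.mp hM.nonneg
  obtain ⟨i, hi⟩ : ∃ i, G i ≠ 0 := by
    by_contra! h
    exact hne (by rw [show G = 0 from funext h]; simp)
  refine ⟨G i, hi, Matrix.PosSemidef.of_dotProduct_mulVec_nonneg ?_ fun x => ?_⟩
  · refine hM.1.sub ?_
    ext a b
    simp [Matrix.vecMulVec_apply, mul_comm]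
  · have h1 : star x ⬝ᵥ (Gᴴ * G) *ᵥ x = ∑ j, (G *ᵥ x) j * (G *ᵥ x) j := by
      rw [← Matrix.mulVec_mulVec, Matrix.dotProduct_mulVec, Matrix.vecMul_conjTranspose]
      simp [dotProduct]
    have h2 : star x ⬝ᵥ Matrix.vecMulVec (G i) (G i) *ᵥ x = (G *ᵥ x) i * (G *ᵥ x) i := by
      rw [Matrix.vecMulVec_mulVec]
      simp [Matrix.mulVec, dotProduct_comm]
    rw [Matrix.sub_mulVec, dotProduct_sub, h1, h2, sub_nonneg]
    exact Finset.single_le_sum (f := fun j => (G *ᵥ x) j * (G *ᵥ x) j)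
      (fun j _ => mul_self_nonneg _) (Finset.mem_univ i)

lemma posSemidef_vecMulVec_self (v : Fin p → ℝ) : (Matrix.vecMulVec v v).PosSemidef := by
  simpa using Matrix.posSemidef_vecMulVec_self_star v

/-- Changing `U` by `-N Eᵀ` and `Y` by `N + Nᵀ`, where `A E = B`, keeps the covariance residual. -/
lemma covResidual_perturb (P : Data n p q) (k : ℕ) (S S' : Matrix (Fin n) (Fin n) ℝ)
    (U : Matrix (Fin p) (Fin n) ℝ) (Y N : Matrix (Fin p) (Fin p) ℝ)
    {E : Matrix (Fin n) (Fin p) ℝ} (hE : P.A k * E = P.B k) :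
    covResidual P k S (U - N * Eᵀ) (Y + N + Nᵀ) S' = covResidual P k S U Y S' := by
  have h1 : P.B k * (N * Eᵀ) * (P.A k)ᵀ = P.B k * N * (P.B k)ᵀ := by
    rw [← hE, Matrix.transpose_mul]
    simp only [Matrix.mul_assoc]
  have h2 : P.A k * (E * Nᵀ) * (P.B k)ᵀ = P.B k * Nᵀ * (P.B k)ᵀ := by
    rw [← Matrix.mul_assoc, hE]
  simp only [covResidual, Matrix.transpose_sub, Matrix.transpose_mul, Matrix.transpose_transpose,
    Matrix.mul_sub, Matrix.sub_mul, Matrix.mul_add, Matrix.add_mul, h1, h2]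
  abel

/-- Expansion of the slack in `N`: the only quadratic term is harmful, which is why `N` must be
small. -/
lemma relaxGap_perturb {S : Matrix (Fin n) (Fin n) ℝ} (hS : S.PosDef)
    (U : Matrix (Fin p) (Fin n) ℝ) (Y N : Matrix (Fin p) (Fin p) ℝ)
    (E : Matrix (Fin n) (Fin p) ℝ) :
    -(relaxGap S (U - N * Eᵀ) (Y + N + Nᵀ)) = -(relaxGap S U Y)
      + N * (1 + U * S⁻¹ * E)ᵀ + (N * (1 + U * S⁻¹ * E)ᵀ)ᵀ - N * (Eᵀ * S⁻¹ * E) * Nᵀ := by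
  have hT : (S⁻¹)ᵀ = S⁻¹ := by simpa using hS.inv.1.eq
  simp only [relaxGap, Matrix.transpose_sub, Matrix.transpose_mul, Matrix.transpose_transpose,
    Matrix.transpose_add, Matrix.transpose_one, Matrix.mul_sub, Matrix.sub_mul, Matrix.mul_add,
    Matrix.mul_one, Matrix.mul_assoc, hT]
  abel

/-- If the relaxation gap at a step is nonzero, then the step can be made strictly cheaper without
changing the covariances before and after it. -/
lemma exists_cheaper_step (P : Data n p q) (k : ℕ) (hA : IsUnit (P.A k)) (hR : (P.R k).PosDef)
    {S : Matrix (Fin n) (Fin n) ℝ} (hS : S.PosDef) (S' : Matrix (Fin n) (Fin n) ℝ)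
    {U : Matrix (Fin p) (Fin n) ℝ} {Y : Matrix (Fin p) (Fin p) ℝ}
    (hgap : (-(relaxGap S U Y)).PosSemidef) (hne : relaxGap S U Y ≠ 0) :
    ∃ U' Y', (-(relaxGap S U' Y')).PosSemidef ∧
      covResidual P k S U' Y' S' = covResidual P k S U Y S' ∧
      (P.R k * Y').trace < (P.R k * Y).trace := by
  obtain ⟨v, hv, hle⟩ := exists_rankOne_le hgap (neg_ne_zero.mpr hne)
  have hE : P.A k * ((P.A k)⁻¹ * P.B k) = P.B k := by
    rw [← Matrix.mul_assoc, Matrix.mul_nonsing_inv _ ((Matrix.isUnit_iff_isUnit_det _).mp hA),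
      Matrix.one_mul]
  set E := (P.A k)⁻¹ * P.B k
  set F := 1 + U * S⁻¹ * E with hF
  set f := F *ᵥ v with hf
  set lam := v ⬝ᵥ (Eᵀ * S⁻¹ * E) *ᵥ v with hlam_def
  have hlam : 0 ≤ lam := by
    have h := (hS.inv.posSemidef.conjTranspose_mul_mul_same E).dotProduct_mulVec_nonneg v
    simpa using h
  have hRv : 0 < v ⬝ᵥ P.R k *ᵥ v := by
    simpa using hR.dotProduct_mulVec_pos hv
  obtain ⟨e, he, he1, he2⟩ := exists_small_pos (v ⬝ᵥ P.R k *ᵥ f) hRv hlam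
  -- The correction `-e • f` makes `v = m + e f`, so that `v vᵀ` absorbs the indefinite cross terms
  -- `-e (m fᵀ + f mᵀ)` exactly.
  set m := v - e • f with hm
  set N := (-e) • Matrix.vecMulVec m v with hN
  refine ⟨U - N * Eᵀ, Y + N + Nᵀ, ?_, covResidual_perturb P k S S' U Y N hE, ?_⟩
  · have h1 : N * Fᵀ = (-e) • Matrix.vecMulVec m f := by
      rw [hN, Matrix.smul_mul, Matrix.vecMulVec_mul, Matrix.vecMul_transpose]
    have h2 : N * (Eᵀ * S⁻¹ * E) * Nᵀ = (e ^ 2 * lam) • Matrix.vecMulVec m m := by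
      rw [hN, Matrix.transpose_smul, Matrix.transpose_vecMulVec, Matrix.smul_mul,
        Matrix.smul_mul, Matrix.mul_smul, Matrix.vecMulVec_mul, Matrix.vecMulVec_mul_vecMulVec,
        ← Matrix.dotProduct_mulVec, ← hlam_def]
      ext i j
      simp [Matrix.vecMulVec_apply]
      ring
    have h3 : -(relaxGap S (U - N * Eᵀ) (Y + N + Nᵀ)) =
        (-(relaxGap S U Y) - Matrix.vecMulVec v v)
          + (1 - e ^ 2 * lam) • Matrix.vecMulVec m m + e ^ 2 • Matrix.vecMulVec f f := by
      rw [relaxGap_perturb hS, ← hF, h1, h2]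
      ext i j
      simp [Matrix.vecMulVec_apply, hm]
      ring
    rw [h3]
    exact (hle.add ((posSemidef_vecMulVec_self m).smul (sub_nonneg.mpr he1))).add
      ((posSemidef_vecMulVec_self f).smul (sq_nonneg e))
  · have hRT : (P.R k)ᵀ = P.R k := by simpa using hR.1.eq
    have h1 : (P.R k * Nᵀ).trace = (P.R k * N).trace := by
      rw [← Matrix.trace_transpose, Matrix.transpose_mul, Matrix.transpose_transpose, hRT,
        Matrix.trace_mul_comm]
    -- To first order in `e` this is `-e vᵀ R v < 0`; `he2` controls the remainder.
    have h2 : (P.R k * N).trace = -e * (v ⬝ᵥ P.R k *ᵥ v - e * (v ⬝ᵥ P.R k *ᵥ f)) := by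
      rw [hN, Matrix.mul_smul, Matrix.trace_smul, Matrix.mul_vecMulVec, Matrix.trace_vecMulVec,
        dotProduct_comm, hm, Matrix.mulVec_sub, Matrix.mulVec_smul, dotProduct_sub,
        dotProduct_smul, smul_eq_mul, smul_eq_mul]
    rw [Matrix.mul_add, Matrix.mul_add, Matrix.trace_add, Matrix.trace_add, h1, h2]
    nlinarith [mul_pos he (sub_pos.mpr he2)]

/-- Distinct steps interact only through the covariances, so replacing `U k` and `Y k` alone
preserves feasibility and the other cost terms. -/
lemma RelaxedOptimal.relaxGap_eq_zero {P : Data n p q} {N : ℕ}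
    {S : ℕ → Matrix (Fin n) (Fin n) ℝ} {U : ℕ → Matrix (Fin p) (Fin n) ℝ}
    {Y : ℕ → Matrix (Fin p) (Fin p) ℝ} (hopt : RelaxedOptimal P N S U Y)
    {k : ℕ} (hk : k < N) (hA : IsUnit (P.A k)) (hR : (P.R k).PosDef) :
    relaxGap (S k) (U k) (Y k) = 0 := by
  by_contra hne
  obtain ⟨hfeas, hmin⟩ := hopt
  obtain ⟨U', Y', hgap, hcov, hlt⟩ := exists_cheaper_step P k hA hR (hfeas.posDef k hk.le)
    (S (k + 1)) (hfeas.gap k hk) hne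
  have hfeas' : RelaxedFeasible P N S (Function.update U k U') (Function.update Y k Y') := by
    refine ⟨hfeas.init, hfeas.final, hfeas.posDef, fun j hj => ?_, fun j hj => ?_⟩
    · rcases eq_or_ne j k with rfl | hjk
      · simpa using hgap
      · simpa [hjk] using hfeas.gap j hj
    · rcases eq_or_ne j k with rfl | hjk
      · simpa using hcov.trans (hfeas.cov j hj)
      · simpa [hjk] using hfeas.cov j hj
  refine absurd (hmin _ _ _ hfeas') (not_le.mpr ?_)
  refine Finset.sum_lt_sum (fun j _ => ?_) ⟨k, Finset.mem_range.mpr hk, by simpa using hlt⟩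
  rcases eq_or_ne j k with rfl | hjk
  · simpa using hlt.le
  · simp [hjk]

lemma OriginalFeasible.relaxedFeasible {P : Data n p q} {N : ℕ}
    {S : ℕ → Matrix (Fin n) (Fin n) ℝ} {U : ℕ → Matrix (Fin p) (Fin n) ℝ}
    (h : OriginalFeasible P N S U) :
    RelaxedFeasible P N S U fun k => U k * (S k)⁻¹ * (U k)ᵀ where
  init := h.init
  final := h.final
  posDef := h.posDef
  gap k _ := by simpa [relaxGap] using Matrix.PosSemidef.zero
  cov := h.cov

end CovSteering

theorem mainTheorem4 {n p q : ℕ} (N : ℕ) (hN : 1 ≤ N) (P : CovSteering.Data n p q)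
    (hA : ∀ k < N, IsUnit (P.A k))
    (hG : (CovSteering.gramian P N).PosDef)
    (hQ : ∀ k < N, (P.Q k).PosSemidef)
    (hR : ∀ k < N, (P.R k).PosDef)
    (hS0 : P.S0.PosDef)
    (hSN : (P.SN - P.D (N - 1) * (P.D (N - 1))ᵀ).PosDef)
    (S : ℕ → Matrix (Fin n) (Fin n) ℝ) (U : ℕ → Matrix (Fin p) (Fin n) ℝ)
    (Y : ℕ → Matrix (Fin p) (Fin p) ℝ)
    (hopt : CovSteering.RelaxedOptimal P N S U Y) :
    (∀ k < N, CovSteering.relaxGap (S k) (U k) (Y k) = 0) ∧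
      CovSteering.OriginalOptimal P N S U := by
  have hgap : ∀ k < N, CovSteering.relaxGap (S k) (U k) (Y k) = 0 := fun k hk =>
    hopt.relaxGap_eq_zero hk (hA k hk) (hR k hk)
  have hY : ∀ k < N, U k * (S k)⁻¹ * (U k)ᵀ = Y k := fun k hk => sub_eq_zero.mp (hgap k hk)
  obtain ⟨hfeas, hmin⟩ := hopt
  refine ⟨hgap, ⟨hfeas.init, hfeas.final, hfeas.posDef, fun k hk => ?_⟩, fun S' U' h' => ?_⟩
  · rw [hY k hk]
    exact hfeas.cov k hk
  · have hcost : CovSteering.originalCost P N S U = CovSteering.relaxedCost P N S Y :=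
      Finset.sum_congr rfl fun k hk => by rw [hY k (Finset.mem_range.mp hk)]
    rw [hcost]
    -- With `Y' = U' S'⁻¹ U'ᵀ` the two costs coincide by definition.
    exact hmin _ _ _ h'.relaxedFeasible
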